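/- For a boolean circuit $c$ of arity $n$ (over constants, NOT, AND, OR), let $\#(c)$ be the number of the $2^n$ inputs on which $c$ evaluates to $1$; for $A\subseteq\mathbb{N}$ let $\mathrm{Counting}(A)\subseteq\{0,1\}^*$ be the set of (encodings of) all circuits $c$ with $\#(c)\in A$. Let $\mathrm{SPP}$ be the class of all languages $L\subseteq\{0,1\}^*$ for which there are $f\in\#\mathrm{P}$ and a polynomial-time computable function $g:\{0,1\}^*\to\{0,1\}^*$ such that, for every $x$, $x\notin L\iff f(x)=2^{|g(x)|}$ and $x\in L\iff f(x)=2^{|g(x)|}+1$. Say that a language $B$ is $\mathrm{SPP}$-hard if every $L\in\mathrm{SPP}$ is polynomial-time Turing reducible to $B$. Let $\mathrm{BH}$ denote the boolean hierarchy (over $\mathrm{NP}$). Let $A\subseteq\mathbb{N}$ be finite or cofinite. Then (i) $\mathrm{Counting}(A)\in\mathrm{BH}$, and (ii) if $\mathrm{Counting}(A)$ is $\mathrm{SPP}$-hard, then $\mathrm{SPP}\subseteq\mathrm{P}^{\mathrm{NP}}$. -/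

import Mathlib

namespace CircuitCounting

/-! ### Words, languages, polynomial-time functions -/

/-- Words over the alphabet `Σ = {0,1}`. -/
abbrev Word := List Bool

/-- `FP`: the functions from words to words that are computable in polynomial time by a
deterministic Turing machine (Mathlib's notion). -/
def FP : Set (Word → Word) :=
  {f | Nonempty (Turing.TM2ComputableInPolyTime (id : Word → List Bool) (id : Word → List Bool) f)}

/-! ### Nondeterministic oracle Turing machines

The machine model is the one used in Mathlib for polynomial-time computation (`Turing.TM2`:
finite control with a finite internal memory and finitely many stacks, a tape being a pair of
stacks), extended by nondeterministic branching and by oracle queries. -/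

/-- What a machine does at a label: one step of a deterministic Mathlib machine, a nondeterministic
jump to one of two labels, or an oracle query, after which the machine jumps to `yes` or `no`
according to the answer. -/
inductive Instr {K : Type} (Γ : K → Type) (Λ σ : Type) where
  | det (s : Turing.TM2.Stmt Γ Λ σ)
  | guess (l₀ l₁ : Λ)
  | ask (yes no : Λ)

/-- A nondeterministic oracle Turing machine. The input is presented on the stack `inp`, and the
queries are read off the stack `qry` (both with binary alphabets, first letter on top). -/
structure Machine where
  /-- the index type of the stacks -/
  K : Type
  /-- the stack alphabets -/
  Γ : K → Type
  /-- the labels (control states) -/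
  Λ : Type
  /-- the internal memory -/
  σ : Type
  [decK : DecidableEq K]
  [finK : Finite K]
  [finΓ : ∀ k, Finite (Γ k)]
  [finΛ : Finite Λ]
  [finσ : Finite σ]
  /-- the input stack -/
  inp : K
  inpEquiv : Γ inp ≃ Bool
  /-- the query stack -/
  qry : K
  qryEquiv : Γ qry ≃ Bool
  /-- the label at which the machine starts -/
  start : Λ
  /-- the internal memory at the start -/
  init : σ
  /-- the program -/
  prog : Λ → Instr Γ Λ σ
  /-- whether the machine accepts when it halts with the given internal memory -/
  accept : σ → Bool

namespace Machine

variable (M : Machine)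

instance : DecidableEq M.K := M.decK

/-- Configurations: label (`none` when the machine has halted), internal memory, stacks. -/
abbrev Cfg := Turing.TM2.Cfg M.Γ M.Λ M.σ

/-- The initial configuration on input `x`. -/
def initCfg (x : Word) : M.Cfg :=
  ⟨some M.start, M.init, Function.update (fun _ => []) M.inp (x.map M.inpEquiv.symm)⟩

open Classical in
/-- The set of possible successors of a configuration, with oracle `O`. A query takes one step
and leaves the query stack unchanged. -/
noncomputable def next (O : Set Word) : M.Cfg → Set M.Cfg
  | ⟨none, _, _⟩ => ∅
  | ⟨some l, v, S⟩ =>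
    match M.prog l with
    | .det s => {Turing.TM2.stepAux s v S}
    | .guess l₀ l₁ => {⟨some l₀, v, S⟩, ⟨some l₁, v, S⟩}
    | .ask yes no =>
        {⟨some (if (S M.qry).map M.qryEquiv ∈ O then yes else no), v, S⟩}

/-- With oracle `O` and from the configuration `c`, every computation path halts after at
most `t` steps. -/
def HaltsWithin (O : Set Word) : ℕ → M.Cfg → Prop
  | 0, c => M.next O c = ∅
  | t + 1, c => ∀ c' ∈ M.next O c, HaltsWithin O t c'

/-- With oracle `O`, the machine runs in polynomial time (on all computation paths). -/
def PolyTime (O : Set Word) : Prop :=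
  ∃ p : Polynomial ℕ, ∀ x : Word, M.HaltsWithin O (p.eval x.length) (M.initCfg x)

/-- The accepting computation paths on input `x` with oracle `O`: the sequences of configurations
that start in the initial configuration, follow the successor relation, and end in a halted,
accepting configuration. -/
def acceptingPaths (O : Set Word) (x : Word) : Set (List M.Cfg) :=
  {π | π.head? = some (M.initCfg x) ∧ π.IsChain (fun c c' => c' ∈ M.next O c) ∧
    ∃ c, π.getLast? = some c ∧ c.l = none ∧ M.accept c.var = true}

/-- The language `L(M^O)` that the machine accepts with oracle `O`. -/
def lang (O : Set Word) : Set Word := {x | (M.acceptingPaths O x).Nonempty}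

/-- The machine never branches nondeterministically. -/
def Deterministic : Prop := ∀ l l₀ l₁, M.prog l ≠ .guess l₀ l₁

/-- The machine never queries its oracle. -/
def OracleFree : Prop := ∀ l yes no, M.prog l ≠ .ask yes no

end Machine

/-! ### Complexity classes -/

/-- Polynomial-time Turing reducibility `L ≤ₜᵖ B`, that is, `L ∈ P^B`. -/
def PolyTuringReducible (L B : Set Word) : Prop :=
  ∃ M : Machine, M.Deterministic ∧ M.PolyTime B ∧ L = M.lang B

/-- `NP`. -/
def NP : Set (Set Word) :=
  {L | ∃ N : Machine, N.OracleFree ∧ N.PolyTime ∅ ∧ L = N.lang ∅}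

/-- `#P`: the functions that count the accepting paths of nondeterministic polynomial-time
Turing machines. -/
def SharpP : Set (Word → ℕ) :=
  {f | ∃ N : Machine, N.OracleFree ∧ N.PolyTime ∅ ∧
    ∀ x, (N.acceptingPaths ∅ x).encard = (f x : ℕ∞)}

/-- `SPP`. -/
def SPP : Set (Set Word) :=
  {L | ∃ f ∈ SharpP, ∃ g ∈ FP, ∀ x : Word,
    (x ∉ L ↔ f x = 2 ^ (g x).length) ∧ (x ∈ L ↔ f x = 2 ^ (g x).length + 1)}

/-- `P^NP`. -/
def PNP : Set (Set Word) := {L | ∃ B ∈ NP, PolyTuringReducible L B}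

/-- The levels of the boolean hierarchy; `BHLevel k` is what is usually called `NP(k + 1)`:
`NP(1) = NP`, `NP(2i) = {L₁ \ L₂ | L₁ ∈ NP(2i - 1), L₂ ∈ NP}`, and
`NP(2i + 1) = {L₁ ∪ L₂ | L₁ ∈ NP(2i), L₂ ∈ NP}`. -/
def BHLevel : ℕ → Set (Set Word)
  | 0 => NP
  | k + 1 => {L | ∃ L₁ ∈ BHLevel k, ∃ L₂ ∈ NP, L = if Even k then L₁ \ L₂ else L₁ ∪ L₂}

/-- The boolean hierarchy `BH`. -/
def BH : Set (Set Word) := {L | ∃ k, L ∈ BHLevel k}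

/-- `B` is hard for the class `C`, with respect to polynomial-time Turing reductions. -/
def IsHard (C : Set (Set Word)) (B : Set Word) : Prop := ∀ L ∈ C, PolyTuringReducible L B

/-! ### Boolean circuits -/

/-- Gates. An operand is a wire, addressed by its distance back from the gate: the wire `0` is the
most recent one. -/
inductive Gate where
  | const (b : Bool)
  | not (i : ℕ)
  | and (i j : ℕ)
  | or (i j : ℕ)

namespace Gate

def operands : Gate → List ℕ
  | const _ => []
  | not i => [i]
  | and i j => [i, j]
  | or i j => [i, j]

/-- The value of a gate, given the values of the earlier wires, most recent first. -/
def value (v : List Bool) : Gate → Bool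
  | const b => b
  | not i => !(v.getD i false)
  | and i j => v.getD i false && v.getD j false
  | or i j => v.getD i false || v.getD j false

end Gate

/-- `WellFormed m gs`: when `m` wires precede the gates `gs`, all operands of these gates are
earlier wires. -/
def WellFormed : ℕ → List Gate → Prop
  | _, [] => True
  | m, g :: gs => (∀ i ∈ g.operands, i < m) ∧ WellFormed (m + 1) gs

/-- The values of all wires (most recent first) after the gates have been evaluated one after the
other, each adding a wire to the given ones. -/
def run : List Gate → List Bool → List Bool
  | [], v => v
  | g :: gs, v => run gs (g.value v :: v)

/-- Boolean circuits: `arity` input wires, followed by gates in topological order. The output is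
the last wire. -/
structure Circuit where
  arity : ℕ
  gates : List Gate
  wellFormed : WellFormed arity gates
  hasOutput : 0 < arity + gates.length

namespace Circuit

/-- The boolean function `{0,1}^n → {0,1}` that the circuit computes. -/
def eval (c : Circuit) (x : Fin c.arity → Bool) : Bool :=
  (run c.gates (List.ofFn x)).headD false

/-- `#(c)`: the number of the `2^n` inputs on which the circuit evaluates to `1`. -/
def count (c : Circuit) : ℕ :=
  (Finset.univ.filter fun x : Fin c.arity → Bool => c.eval x = true).card

end Circuit

/-- The self-delimiting unary code of a number. -/
def unary (n : ℕ) : Word := List.replicate n true ++ [false]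

/-- The code of a gate: two bits for its kind, followed by its operands in unary (or, for a
constant, by its value). -/
def Gate.encode : Gate → Word
  | const b => [false, false, b]
  | not i => [false, true] ++ unary i
  | and i j => [true, false] ++ unary i ++ unary j
  | or i j => [true, true] ++ unary i ++ unary j

/-- The code of a circuit: its arity in unary, followed by the codes of its gates. -/
def Circuit.encode (c : Circuit) : Word := unary c.arity ++ c.gates.flatMap Gate.encode

/-- `Counting(A)`: the set of all (codes of) circuits `c` with `#(c) ∈ A`. -/
def Counting (A : Set ℕ) : Set Word := {w | ∃ c : Circuit, c.encode = w ∧ c.count ∈ A}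

end CircuitCounting

namespace CircuitCounting

/-! ### Acceptance and running time of machines -/

namespace Machine

variable (M : Machine)

/-! Membership in a finite or cofinite set `A` is constant from some `N` on (`exists_threshold`), so
whether `#(c) ∈ A` depends only on which of the conditions `k ≤ #(c)` with `k ≤ N` hold. Each
language `AtLeast k` is in `NP` (`atLeast_mem_NP`): guess `k` assignments, check that they are
distinct and satisfying. Hence `Counting A` is a boolean combination of `NP` languages, and
`counting_inter_Iio_mem_BHLevel` arranges it as alternating unions and differences.

The second part is the inclusion of `P^(Counting A)` in `P^NP`, whatever the class in place of
`SPP`. A query `w` is answered by asking `w ∈ AtLeast t` for `t = 0, 1, ..., N` until the first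
refusal: a refusal at `0` means that `w` is not a code, one at `t > 0` that the count is `t - 1`,
and no refusal that the count is at least `N`. The threshold is put in front of the query as a unary
tag, so one language `TaggedAtLeast N` in `NP` serves as oracle (`Simulation.polyTuringReducible`).

For `NP` membership the number `K` of evaluations is fixed, so a stack letter can hold the values of
one wire in all `K` of them. The assignments are guessed one input wire at a time, and a finite
table records the pairs already seen to differ. The circuit is parsed and evaluated in a single pass
over its code. -/

/-- Some computation path from the given configuration halts and accepts. -/
inductive Accepts (O : Set Word) : M.Cfg → Prop
  | halt {c : M.Cfg} (hl : c.l = none) (ha : M.accept c.var = true) : Accepts O c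
  | step {c c' : M.Cfg} (hc : c' ∈ M.next O c) (h : Accepts O c') : Accepts O c

/-- The machine passes deterministically from one configuration to another one in `n` steps. -/
inductive Reach (O : Set Word) : ℕ → M.Cfg → M.Cfg → Prop
  | refl (c : M.Cfg) : Reach O 0 c c
  | step {n : ℕ} {c c₁ c₂ : M.Cfg} (hc : M.next O c = {c₁}) (h : Reach O n c₁ c₂) :
      Reach O (n + 1) c c₂

variable {M} {O : Set Word}

theorem next_of_halted {c : M.Cfg} (h : c.l = none) : M.next O c = ∅ := by
  obtain ⟨l, v, S⟩ := c
  simp only at h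
  subst h
  rfl

theorem next_det {l : M.Λ} {s : Turing.TM2.Stmt M.Γ M.Λ M.σ} (h : M.prog l = .det s)
    (v : M.σ) (S : ∀ k, List (M.Γ k)) :
    M.next O ⟨some l, v, S⟩ = {Turing.TM2.stepAux s v S} := by
  simp only [next, h]

theorem next_guess {l l₀ l₁ : M.Λ} (h : M.prog l = .guess l₀ l₁)
    (v : M.σ) (S : ∀ k, List (M.Γ k)) :
    M.next O ⟨some l, v, S⟩ = {⟨some l₀, v, S⟩, ⟨some l₁, v, S⟩} := by
  simp only [next, h]

open Classical in
theorem next_ask {l yes no : M.Λ} (h : M.prog l = .ask yes no)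
    (v : M.σ) (S : ∀ k, List (M.Γ k)) :
    M.next O ⟨some l, v, S⟩ =
      {⟨some (if (S M.qry).map M.qryEquiv ∈ O then yes else no), v, S⟩} := by
  simp only [next, h]

theorem accepts_of_halted {c : M.Cfg} (h : c.l = none) :
    M.Accepts O c ↔ M.accept c.var = true := by
  refine ⟨fun H => ?_, fun H => .halt h H⟩
  cases H with
  | halt _ ha => exact ha
  | step hc _ => simp [next_of_halted h] at hc

theorem accepts_iff_exists {c : M.Cfg} (h : (M.next O c).Nonempty) :
    M.Accepts O c ↔ ∃ c' ∈ M.next O c, M.Accepts O c' := by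
  refine ⟨fun H => ?_, fun ⟨c', hc, H⟩ => .step hc H⟩
  cases H with
  | halt hl _ => simp [next_of_halted hl] at h
  | step hc H => exact ⟨_, hc, H⟩

theorem accepts_of_next_eq {c c' : M.Cfg} (h : M.next O c = {c'}) :
    M.Accepts O c ↔ M.Accepts O c' := by
  rw [accepts_iff_exists (by simp [h])]
  simp [h]

theorem Reach.accepts_iff {n : ℕ} {c c' : M.Cfg} (h : M.Reach O n c c') :
    M.Accepts O c ↔ M.Accepts O c' := by
  induction h with
  | refl c => exact Iff.rfl
  | step hc _ ih => rw [accepts_of_next_eq hc, ih]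

theorem Reach.haltsWithin {n t : ℕ} {c c' : M.Cfg} (h : M.Reach O n c c')
    (H : M.HaltsWithin O t c') : M.HaltsWithin O (t + n) c := by
  induction h with
  | refl c => exact H
  | step hc _ ih =>
    intro d hd
    rw [hc, Set.mem_singleton_iff] at hd
    exact hd ▸ ih H

theorem Reach.trans {m n : ℕ} {c₁ c₂ c₃ : M.Cfg} (h : M.Reach O m c₁ c₂)
    (h' : M.Reach O n c₂ c₃) : M.Reach O (m + n) c₁ c₃ := by
  induction h with
  | refl c => simpa using h'
  | step hc _ ih => rw [Nat.add_right_comm]; exact .step hc (ih h')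

theorem HaltsWithin.succ {t : ℕ} {c : M.Cfg} (h : M.HaltsWithin O t c) :
    M.HaltsWithin O (t + 1) c := by
  induction t generalizing c with
  | zero => intro d hd; rw [HaltsWithin] at h; simp [h] at hd
  | succ t ih => exact fun d hd => ih (h d hd)

theorem HaltsWithin.mono {s t : ℕ} {c : M.Cfg} (h : M.HaltsWithin O s c) (hst : s ≤ t) :
    M.HaltsWithin O t c := by
  induction hst with
  | refl => exact h
  | step _ ih => exact ih.succ

theorem haltsWithin_of_potential (Φ : M.Cfg → ℕ)
    (hΦ : ∀ c, ∀ c' ∈ M.next O c, Φ c' < Φ c) {t : ℕ} {c : M.Cfg} (h : Φ c ≤ t) :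
    M.HaltsWithin O t c := by
  induction t generalizing c with
  | zero =>
    refine Set.eq_empty_iff_forall_notMem.2 fun c' hc' => ?_
    have := hΦ c c' hc'
    omega
  | succ t ih =>
    intro c' hc'
    have := hΦ c c' hc'
    exact ih (by omega)

/-- Bridge from the definition by lists of configurations to the inductive predicate, which can be
rewritten one machine step at a time. -/
theorem accepts_iff_exists_path {c : M.Cfg} : M.Accepts O c ↔
    ∃ π : List M.Cfg, π.head? = some c ∧ π.IsChain (fun c c' => c' ∈ M.next O c) ∧
      ∃ d, π.getLast? = some d ∧ d.l = none ∧ M.accept d.var = true := by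
  constructor
  · intro h
    induction h with
    | halt hl ha => exact ⟨[_], rfl, .singleton _, _, rfl, hl, ha⟩
    | @step c c' hc _ ih =>
      obtain ⟨π, h₁, h₂, d, h₃, h₄⟩ := ih
      refine ⟨c :: π, rfl, h₂.cons ?_, d, ?_, h₄⟩
      · intro y hy
        simp only [h₁, Option.mem_def, Option.some.injEq] at hy
        exact hy ▸ hc
      · rw [List.getLast?_cons, h₃]
        rfl
  · rintro ⟨π, h₁, h₂, d, h₃, h₄, h₅⟩
    induction π generalizing c with
    | nil => simp at h₁
    | cons a π ih =>
      simp only [List.head?_cons, Option.some.injEq] at h₁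
      subst h₁
      rw [List.isChain_cons] at h₂
      cases π with
      | nil =>
        simp only [List.getLast?_singleton, Option.some.injEq] at h₃
        exact h₃ ▸ .halt (h₃ ▸ h₄) (h₃ ▸ h₅)
      | cons b π =>
        exact .step (h₂.1 b rfl) (ih rfl h₂.2 (by simpa [List.getLast?_cons_cons] using h₃))

theorem mem_lang {x : Word} : x ∈ M.lang O ↔ M.Accepts O (M.initCfg x) :=
  accepts_iff_exists_path.symm

end Machine

/-! ### A machine that evaluates a circuit on several guessed inputs in parallel -/

namespace Counter

open Turing.TM2

/-- The stacks: the input, the values of the wires, and the values removed during a lookup. -/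
inductive Stk where
  | inp | val | tmp
  deriving DecidableEq

instance : Fintype Stk := ⟨{.inp, .val, .tmp}, fun k => by cases k <;> simp⟩

/-- The truth values of a wire in `K` evaluations of a circuit. -/
abbrev Vec (K : ℕ) : Type := Fin K → Bool

/-- The stack alphabets. -/
abbrev Alph (K : ℕ) : Stk → Type
  | .inp => Bool
  | .val => Vec K
  | .tmp => Vec K

/-- What to do with the operand that is being looked up: negate it, keep it as the first operand
of a binary gate, or combine it with the first operand. -/
inductive Pending (K : ℕ) where
  | neg
  | fst (disj : Bool)
  | snd (disj : Bool) (u : Vec K)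
  deriving Fintype

/-- The control states. -/
inductive Label (K : ℕ) where
  | reject | tag | arity | gate | const | final
  | guess (i : Fin (K + 1)) (v : Vec K)
  | kind (b : Bool)
  | look (p : Pending K)
  | restore (p : Pending K) (u : Vec K)
  deriving Fintype

/-- The internal memory: the number of evaluations that matter, a table of the pairs of evaluations
whose inputs differ, the last symbols read, and the verdict. -/
structure Mem (K : ℕ) where
  thr : Fin (K + 1)
  diff : Fin K → Fin K → Bool
  bit : Option Bool
  vec : Option (Vec K)
  ok : Bool
  deriving Fintype

variable {K : ℕ}

/-- The internal memory without the symbols read and the verdict. -/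
def Mem.env (thr : Fin (K + 1)) (diff : Fin K → Fin K → Bool) : Mem K :=
  ⟨thr, diff, none, none, false⟩

/-- The operand with which a lookup ends is processed. -/
def finish (u : Vec K) : Pending K → Stmt (Alph K) (Label K) (Mem K)
  | .neg => .push .val (fun _ k => !u k) (.goto fun _ => .gate)
  | .fst d => .goto fun _ => .look (.snd d u)
  | .snd false v => .push .val (fun _ k => v k && u k) (.goto fun _ => .gate)
  | .snd true v => .push .val (fun _ k => v k || u k) (.goto fun _ => .gate)

/-- The condition under which the machine accepts when the output wire has the values `u`. -/
def Verdict (thr : Fin (K + 1)) (diff : Fin K → Fin K → Bool) (u : Vec K) : Prop :=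
  (∀ i : Fin K, i.val < thr.val → u i = true) ∧
    ∀ i j : Fin K, i.val < thr.val → j.val < thr.val → i ≠ j → diff i j = true

open Classical in
/-- The deterministic part of the program. -/
noncomputable def body : Label K → Stmt (Alph K) (Label K) (Mem K)
  | .reject => .halt
  | .tag => .pop .inp (fun m o => { m with bit := o })
      (.load (fun m => if m.bit = some true then { m with thr := m.thr + 1 } else m)
        (.goto fun m => match m.bit with
          | none => .reject
          | some true => .tag
          | some false => .arity))
  | .arity => .pop .inp (fun m o => { m with bit := o })
      (.goto fun m => match m.bit with
        | none => .reject
        | some true => .guess 0 (fun _ => false)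
        | some false => .gate)
  | .guess _ v => .push .val (fun _ => v)
      (.load (fun m => { m with diff := fun i j => v i != v j || m.diff i j })
        (.goto fun _ => .arity))
  | .gate => .pop .inp (fun m o => { m with bit := o })
      (.goto fun m => match m.bit with
        | none => .final
        | some b => .kind b)
  | .kind b => .pop .inp (fun m o => { m with bit := o })
      (.goto fun m => match b, m.bit with
        | _, none => .reject
        | false, some false => .const
        | false, some true => .look .neg
        | true, some d => .look (.fst d))
  | .const => .pop .inp (fun m o => { m with bit := o })
      (.branch (fun m => m.bit.isSome)
        (.push .val (fun m _ => m.bit.getD false) (.goto fun _ => .gate))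
        (.goto fun _ => .reject))
  | .look p => .pop .inp (fun m o => { m with bit := o })
      (.branch (fun m => m.bit == some true)
        (.pop .val (fun m o => { m with vec := o })
          (.branch (fun m => m.vec.isSome)
            (.push .tmp (fun m => m.vec.getD fun _ => false) (.goto fun _ => .look p))
            (.goto fun _ => .reject)))
        (.peek .val (fun m o => { m with vec := o })
          (.goto fun m => match m.bit, m.vec with
            | some false, some u => .restore p u
            | _, _ => .reject)))
  | .restore p u => .pop .tmp (fun m o => { m with vec := o })
      (.branch (fun m => m.vec.isSome)
        (.push .val (fun m => m.vec.getD fun _ => false) (.goto fun _ => .restore p u))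
        (finish u p))
  | .final => .peek .val (fun m o => { m with vec := o })
      (.load (fun m => { m with ok := match m.vec with
        | none => false
        | some u => decide (Verdict m.thr m.diff u) })
      .halt)

/-- The program. -/
noncomputable def prog (l : Label K) : Instr (Alph K) (Label K) (Mem K) :=
  match l with
  | .guess i v =>
    if h : i.val < K then
      .guess (.guess ⟨i + 1, by omega⟩ (Function.update v ⟨i, h⟩ false))
        (.guess ⟨i + 1, by omega⟩ (Function.update v ⟨i, h⟩ true))
    else .det (.load (fun m => .env m.thr m.diff) (body l))
  | l => .det (.load (fun m => .env m.thr m.diff) (body l))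

/-- The machine, with a given start state and a given number of evaluations that matter. -/
noncomputable def machine (K : ℕ) (start : Label K) (thr : Fin (K + 1)) : Machine where
  K := Stk
  Γ := Alph K
  Λ := Label K
  σ := Mem K
  finΓ k := by cases k <;> (dsimp only [Alph]; infer_instance)
  inp := .inp
  inpEquiv := Equiv.refl Bool
  qry := .inp
  qryEquiv := Equiv.refl Bool
  start := start
  init := .env thr fun _ _ => false
  prog := prog
  accept := Mem.ok

/-- The contents of the stacks. -/
def tapes (inp : Word) (val tmp : List (Vec K)) : ∀ k, List (Alph K k)
  | .inp => inp
  | .val => val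
  | .tmp => tmp

theorem eq_tapes (S : ∀ k, List (Alph K k)) : S = tapes (S .inp) (S .val) (S .tmp) := by
  funext k
  cases k <;> rfl

section

variable (inp inp' : Word) (val val' tmp tmp' : List (Vec K))

@[simp] theorem tapes_inp : tapes inp val tmp .inp = inp := rfl
@[simp] theorem tapes_val : tapes inp val tmp .val = val := rfl
@[simp] theorem tapes_tmp : tapes inp val tmp .tmp = tmp := rfl

@[simp] theorem update_inp :
    Function.update (tapes inp val tmp) .inp inp' = tapes inp' val tmp := by
  funext k; cases k <;> simp [Function.update, tapes]

@[simp] theorem update_val :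
    Function.update (tapes inp val tmp) .val val' = tapes inp val' tmp := by
  funext k; cases k <;> simp [Function.update, tapes]

@[simp] theorem update_tmp :
    Function.update (tapes inp val tmp) .tmp tmp' = tapes inp val tmp' := by
  funext k; cases k <;> simp [Function.update, tapes]

end

variable {s : Label K} {t₀ : Fin (K + 1)} {O : Set Word}

theorem prog_ne_ask (l yes no : Label K) : prog l ≠ .ask yes no := by
  unfold prog
  split
  · split <;> simp
  · simp

theorem machine_oracleFree : (machine K s t₀).OracleFree := prog_ne_ask

/-- The configurations. -/
abbrev Conf (K : ℕ) : Type := Cfg (Alph K) (Label K) (Mem K)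

variable (s t₀ O) in
/-- The possible successors of a configuration. -/
def succs : Conf K → Set (Conf K) := (machine K s t₀).next O

/-- The labels at which the machine takes a deterministic step. -/
def Label.Det : Label K → Prop
  | .guess i _ => i.val = K
  | _ => True

theorem prog_of_det {l : Label K} (h : l.Det) :
    prog l = .det (.load (fun m => .env m.thr m.diff) (body l)) := by
  unfold prog
  split
  · rw [dif_neg]
    simp only [Label.Det] at h
    omega
  · rfl

theorem next_of_det {l : Label K} (h : l.Det) (m : Mem K) (S : ∀ k, List (Alph K k)) :
    succs s t₀ O ⟨some l, m, S⟩ = {stepAux (body l) (.env m.thr m.diff) S} :=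
  Machine.next_det (M := machine K s t₀) (prog_of_det h) m S

theorem next_of_guess {i : Fin (K + 1)} {v : Vec K} (h : i.val < K) (m : Mem K)
    (S : ∀ k, List (Alph K k)) :
    succs s t₀ O ⟨some (.guess i v), m, S⟩ =
      {⟨some (.guess ⟨i + 1, by omega⟩ (Function.update v ⟨i, h⟩ false)), m, S⟩,
        ⟨some (.guess ⟨i + 1, by omega⟩ (Function.update v ⟨i, h⟩ true)), m, S⟩} :=
  Machine.next_guess (M := machine K s t₀) (l := Label.guess i v) (dif_pos h) m S

theorem initCfg_eq (x : Word) :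
    (machine K s t₀).initCfg x = ⟨some s, .env t₀ fun _ _ => false, tapes x [] []⟩ := by
  change (⟨some s, .env t₀ fun _ _ => false, Function.update (fun _ => []) .inp (x.map id)⟩ :
    Conf K) = _
  rw [List.map_id, eq_tapes fun _ => [], update_inp]
  rfl

/-! ### Linear running time -/

/-- The potential that bounds the remaining running time. -/
def potential : Conf K → ℕ
  | ⟨none, _, _⟩ => 0
  | ⟨some l, _, S⟩ => (K + 6) * (S .inp).length + (S .tmp).length + match l with
    | .reject => 1
    | .final => 1
    | .guess i _ => K + 3 - i.val
    | .restore _ _ => 3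
    | _ => 2

/-- A letter weighs `K + 6`, enough to pay for the `K` binary guesses an arity letter triggers or
for the vector a lookup moves to `tmp`. Restoring reads no input: it is paid for by the shrinking
`tmp` stack, and its label weighs 3 so that leaving it for a label of weight 2 is still a decrease.
-/
theorem potential_lt {c c' : Conf K} (h : c' ∈ succs s t₀ O c) : potential c' < potential c := by
  obtain ⟨_ | l, m, S⟩ := c
  · exact absurd h (Set.notMem_empty c')
  by_cases hl : l.Det
  · rw [next_of_det hl, Set.mem_singleton_iff] at h
    subst h
    rw [eq_tapes S]
    generalize S .inp = inp, S .val = val, S .tmp = tmp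
    cases l with
    | reject => simp [body, potential]
    | tag => rcases inp with _ | ⟨_ | _, inp⟩ <;> simp [body, potential, mul_add]
    | arity => rcases inp with _ | ⟨_ | _, inp⟩ <;> (simp [body, potential, mul_add]; try omega)
    | gate => rcases inp with _ | ⟨_ | _, inp⟩ <;> simp [body, potential, mul_add]
    | const => rcases inp with _ | ⟨_ | _, inp⟩ <;> simp [body, potential, mul_add]
    | final => simp [body, potential]
    | guess i v =>
      simp only [Label.Det] at hl
      simp [body, potential, hl]
    | kind b => rcases inp with _ | ⟨_ | _, inp⟩ <;> cases b <;>
        simp [body, potential, mul_add]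
    | look p =>
      rcases inp with _ | ⟨_ | _, inp⟩ <;> rcases val with _ | ⟨v, val⟩ <;>
        simp [body, potential, mul_add] <;> omega
    | restore p u =>
      rcases tmp with _ | ⟨v, tmp⟩
      · rcases p with _ | _ | ⟨_ | _, _⟩ <;> simp [body, finish, potential]
      · simp [body, potential]
  · cases l with
    | guess i v =>
      have hi : i.val < K := by
        simp only [Label.Det] at hl
        omega
      rw [next_of_guess hi] at h
      rcases h with rfl | rfl <;> simp only [potential] <;> omega
    | _ => exact absurd trivial hl

theorem machine_polyTime : (machine K s t₀).PolyTime O := by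
  refine ⟨.C (K + 6) * .X + .C (K + 5), fun x => ?_⟩
  refine Machine.haltsWithin_of_potential potential (fun c c' h => potential_lt h) ?_
  rw [initCfg_eq]
  cases s <;> (simp [potential]; try omega)

/-! ### Transitions as equivalences between accepting configurations -/

/-- Some computation path from the given configuration halts and accepts. -/
def Accepts (s : Label K) (t₀ : Fin (K + 1)) : Conf K → Prop := (machine K s t₀).Accepts ∅

/-- The configuration with the given control state, environment and stacks is accepting. -/
def Acc (s : Label K) (t₀ t : Fin (K + 1)) (d : Fin K → Fin K → Bool) (l : Label K)
    (inp : Word) (val tmp : List (Vec K)) : Prop :=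
  Accepts s t₀ ⟨some l, .env t d, tapes inp val tmp⟩

variable {s : Label K} {t₀ t : Fin (K + 1)} {d : Fin K → Fin K → Bool}
  {inp : Word} {val tmp : List (Vec K)}

theorem accepts_iff_exists {c : Conf K} (h : (succs s t₀ ∅ c).Nonempty) :
    Accepts s t₀ c ↔ ∃ c' ∈ succs s t₀ ∅ c, Accepts s t₀ c' :=
  Machine.accepts_iff_exists h

theorem accepts_of_det {l : Label K} (m : Mem K) (S : ∀ k, List (Alph K k))
    (h : l.Det := by exact trivial) :
    Accepts s t₀ ⟨some l, m, S⟩ ↔ Accepts s t₀ (stepAux (body l) (.env m.thr m.diff) S) :=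
  Machine.accepts_of_next_eq (next_of_det (O := ∅) h m S)

theorem accepts_halted (m : Mem K) (S : ∀ k, List (Alph K k)) :
    Accepts s t₀ ⟨none, m, S⟩ ↔ m.ok = true :=
  Machine.accepts_of_halted rfl

/-- The symbols read before do not matter for a deterministic step. -/
theorem accepts_iff_acc {l : Label K} (m : Mem K) (h : l.Det := by exact trivial) :
    Accepts s t₀ ⟨some l, m, tapes inp val tmp⟩ ↔ Acc s t₀ m.thr m.diff l inp val tmp := by
  rw [accepts_of_det _ _ h, Acc, accepts_of_det _ _ h]
  rfl

/-- Every deterministic step first clears the symbols read and the verdict, so of the memory `m`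
left behind only the threshold and the table matter. This makes each transition a rewriting rule. -/
theorem acc_of_stepAux {l l' : Label K} {m : Mem K} {inp' : Word} {val' tmp' : List (Vec K)}
    (H : stepAux (body l) (.env t d) (tapes inp val tmp) = ⟨some l', m, tapes inp' val' tmp'⟩)
    (h : l.Det := by exact trivial) (h' : l'.Det := by exact trivial) :
    Acc s t₀ t d l inp val tmp ↔ Acc s t₀ m.thr m.diff l' inp' val' tmp' := by
  rw [← accepts_iff_acc _ h', ← H]
  exact accepts_of_det _ _ h

theorem not_acc_reject : ¬ Acc s t₀ t d .reject inp val tmp := by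
  rw [Acc, accepts_of_det, body, stepAux, accepts_halted]
  exact Bool.false_ne_true

theorem not_acc_of_stepAux {l : Label K} {m : Mem K} {inp' : Word} {val' tmp' : List (Vec K)}
    (H : stepAux (body l) (.env t d) (tapes inp val tmp) =
      ⟨some .reject, m, tapes inp' val' tmp'⟩) (h : l.Det := by exact trivial) :
    ¬ Acc s t₀ t d l inp val tmp := by
  rw [acc_of_stepAux H h]
  exact not_acc_reject

/-! #### The tag and the arity -/

theorem acc_tag_true :
    Acc s t₀ t d .tag (true :: inp) val tmp ↔ Acc s t₀ (t + 1) d .tag inp val tmp :=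
  acc_of_stepAux (m := ⟨t + 1, d, some true, none, false⟩) (by simp [body, Mem.env])

theorem acc_tag_false :
    Acc s t₀ t d .tag (false :: inp) val tmp ↔ Acc s t₀ t d .arity inp val tmp :=
  acc_of_stepAux (m := ⟨t, d, some false, none, false⟩) (by simp [body, Mem.env])

theorem not_acc_arity_nil : ¬ Acc s t₀ t d .arity [] val tmp :=
  not_acc_of_stepAux (m := .env t d) (by simp [body, Mem.env]; rfl)

theorem acc_arity_false :
    Acc s t₀ t d .arity (false :: inp) val tmp ↔ Acc s t₀ t d .gate inp val tmp :=
  acc_of_stepAux (m := ⟨t, d, some false, none, false⟩) (by simp [body, Mem.env])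

theorem acc_guess_last {i : Fin (K + 1)} (hi : i.val = K) (v : Vec K) (m : Mem K) :
    Accepts s t₀ ⟨some (.guess i v), m, tapes inp val tmp⟩ ↔
      Acc s t₀ m.thr (fun a b => v a != v b || m.diff a b) .arity inp (v :: val) tmp := by
  rw [accepts_iff_acc (l := .guess i v) _ hi]
  exact acc_of_stepAux (m := .env m.thr fun a b => v a != v b || m.diff a b)
    (by simp [body, Mem.env]) hi

theorem accepts_guess {i : Fin (K + 1)} {v : Vec K} (h : i.val < K) (m : Mem K)
    (S : ∀ k, List (Alph K k)) : Accepts s t₀ ⟨some (.guess i v), m, S⟩ ↔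
      Accepts s t₀ ⟨some (.guess ⟨i + 1, by omega⟩ (Function.update v ⟨i, h⟩ false)), m, S⟩ ∨
      Accepts s t₀ ⟨some (.guess ⟨i + 1, by omega⟩ (Function.update v ⟨i, h⟩ true)), m, S⟩ := by
  have hn := next_of_guess (s := s) (t₀ := t₀) (O := ∅) (v := v) h m S
  rw [accepts_iff_exists (by rw [hn]; exact ⟨_, Or.inl rfl⟩), hn]
  simp

/-- The coordinates below `i` are settled in `v` and the other `n` are still to be guessed, one per
step. -/
theorem acc_guess (n : ℕ) {i : Fin (K + 1)} (hi : i.val + n = K) (v : Vec K) (m : Mem K) :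
    Accepts s t₀ ⟨some (.guess i v), m, tapes inp val tmp⟩ ↔
      ∃ u : Vec K, (∀ a : Fin K, a.val < i.val → u a = v a) ∧
        Acc s t₀ m.thr (fun a b => u a != u b || m.diff a b) .arity inp (u :: val) tmp := by
  induction n generalizing i v with
  | zero =>
    rw [acc_guess_last hi]
    refine ⟨fun h => ⟨v, fun _ _ => rfl, h⟩, fun ⟨u, hu, h⟩ => ?_⟩
    obtain rfl : u = v := funext fun a => hu a (by omega)
    exact h
  | succ n ih =>
    have hlt : i.val < K := by omega
    rw [accepts_guess hlt]
    -- Each branch yields exactly the vectors whose coordinate `i` is the guessed bit.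
    have key : ∀ b : Bool, Accepts s t₀ ⟨some (.guess ⟨i + 1, by omega⟩
        (Function.update v ⟨i, hlt⟩ b)), m, tapes inp val tmp⟩ ↔
        ∃ u : Vec K, (u ⟨i, hlt⟩ = b ∧ ∀ a : Fin K, a.val < i.val → u a = v a) ∧
          Acc s t₀ m.thr (fun a b => u a != u b || m.diff a b) .arity inp (u :: val) tmp := by
      intro b
      rw [ih (i := ⟨i + 1, by omega⟩) (by simp only; omega)]
      refine exists_congr fun u => and_congr_left fun _ => ⟨fun H => ⟨?_, fun a ha => ?_⟩,
        fun H a ha => ?_⟩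
      · simpa using H ⟨i, hlt⟩ (by simp)
      · have := H a (by simp only; omega)
        rwa [Function.update_of_ne (by rintro rfl; simp at ha)] at this
      · by_cases hai : a = ⟨i, hlt⟩
        · simpa [hai] using H.1
        · rw [Function.update_of_ne hai]
          refine H.2 a ?_
          have : a.val ≠ i.val := fun h => hai (Fin.ext h)
          simp only at ha
          omega
    constructor
    · rintro (hc | hc)
      · obtain ⟨u, hu, h⟩ := (key false).1 hc
        exact ⟨u, hu.2, h⟩
      · obtain ⟨u, hu, h⟩ := (key true).1 hc
        exact ⟨u, hu.2, h⟩
    · rintro ⟨u, hu, h⟩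
      cases hb : u ⟨i, hlt⟩
      · exact Or.inl ((key false).2 ⟨u, ⟨hb, hu⟩, h⟩)
      · exact Or.inr ((key true).2 ⟨u, ⟨hb, hu⟩, h⟩)

theorem acc_arity_true :
    Acc s t₀ t d .arity (true :: inp) val tmp ↔
      ∃ u : Vec K, Acc s t₀ t (fun a b => u a != u b || d a b) .arity inp (u :: val) tmp := by
  rw [Acc, accepts_of_det]
  have : stepAux (body .arity) (.env t d) (tapes (true :: inp) val tmp) =
      (⟨some (.guess 0 fun _ => false), ⟨t, d, some true, none, false⟩, tapes inp val tmp⟩ :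
        Conf K) := by simp [body, Mem.env]
  change Accepts s t₀
    (stepAux (body .arity) (.env t d) (tapes (true :: inp) val tmp)) ↔ _
  rw [this, acc_guess K (by simp)]
  simp

/-- The pairs of evaluations in which some of the given wires have different values. -/
def differ (val : List (Vec K)) (a b : Fin K) : Bool := val.any fun v => v a != v b

/-- While the arity is read, all wires are input wires, so the table `differ val` says exactly which
assignments differ so far. It is not updated afterwards, when gates are added. -/
theorem acc_arity {w : Word} : Acc s t₀ t (differ val) .arity w val tmp ↔
    ∃ vs : List (Vec K), ∃ r, w = unary vs.length ++ r ∧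
      Acc s t₀ t (differ (vs ++ val)) .gate r (vs ++ val) tmp := by
  induction w generalizing val with
  | nil => simp [not_acc_arity_nil, unary]
  | cons b w ih =>
    cases b with
    | false =>
      rw [acc_arity_false]
      refine ⟨fun h => ⟨[], w, rfl, h⟩, ?_⟩
      rintro ⟨vs, r, h, H⟩
      cases vs with
      | nil =>
        simp only [unary, List.length_nil, List.replicate_zero, List.nil_append,
          List.singleton_append, List.cons.injEq, true_and] at h
        exact h ▸ H
      | cons v vs => simp [unary, List.replicate_succ] at h
    | true =>
      rw [acc_arity_true]
      have key : ∀ u : Vec K, Acc s t₀ t (fun a b => u a != u b || differ val a b) .arity w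
          (u :: val) tmp ↔ Acc s t₀ t (differ (u :: val)) .arity w (u :: val) tmp := fun _ => Iff.rfl
      simp only [key, ih]
      constructor
      · rintro ⟨u, vs, r, h, H⟩
        -- The stack grows at its front, so the vector guessed first comes last.
        refine ⟨vs ++ [u], r, ?_, by simpa using H⟩
        simp [h, unary, List.replicate_succ]
      · rintro ⟨vs, r, h, H⟩
        rcases List.eq_nil_or_concat vs with rfl | ⟨vs, u, rfl⟩
        · simp [unary] at h
        · refine ⟨u, vs, r, ?_, by simpa using H⟩
          simpa [unary, List.replicate_succ] using h

/-! #### Lookups -/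

theorem acc_look_true (p : Pending K) (v : Vec K) :
    Acc s t₀ t d (.look p) (true :: inp) (v :: val) tmp ↔
      Acc s t₀ t d (.look p) inp val (v :: tmp) :=
  acc_of_stepAux (m := ⟨t, d, some true, some v, false⟩) (by simp [body, Mem.env])

theorem acc_look_false (p : Pending K) (v : Vec K) :
    Acc s t₀ t d (.look p) (false :: inp) (v :: val) tmp ↔
      Acc s t₀ t d (.restore p v) inp (v :: val) tmp :=
  acc_of_stepAux (m := ⟨t, d, some false, some v, false⟩) (by simp [body, Mem.env])

theorem not_acc_look_nil (p : Pending K) : ¬ Acc s t₀ t d (.look p) [] val tmp :=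
  not_acc_of_stepAux (m := ⟨t, d, none, val.head?, false⟩) (inp' := []) (val' := val)
    (tmp' := tmp) (by simp [body, Mem.env])

theorem not_acc_look_empty (p : Pending K) (b : Bool) :
    ¬ Acc s t₀ t d (.look p) (b :: inp) [] tmp := by
  cases b
  · exact not_acc_of_stepAux (m := ⟨t, d, some false, none, false⟩) (inp' := inp) (val' := [])
      (tmp' := tmp) (by simp [body, Mem.env])
  · exact not_acc_of_stepAux (m := ⟨t, d, some true, none, false⟩) (inp' := inp) (val' := [])
      (tmp' := tmp) (by simp [body, Mem.env])

theorem acc_restore_cons (p : Pending K) (u v : Vec K) :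
    Acc s t₀ t d (.restore p u) inp val (v :: tmp) ↔
      Acc s t₀ t d (.restore p u) inp (v :: val) tmp :=
  acc_of_stepAux (m := ⟨t, d, none, some v, false⟩) (by simp [body, Mem.env])

theorem acc_restore (p : Pending K) (u : Vec K) :
    Acc s t₀ t d (.restore p u) inp val tmp ↔
      Acc s t₀ t d (.restore p u) inp (tmp.reverse ++ val) [] := by
  induction tmp generalizing val with
  | nil => simp
  | cons v tmp ih => rw [acc_restore_cons, ih]; simp

/-- The operand is found by moving `i` vectors to `tmp`; moving them back reverses them again, so
the wires are unchanged for the next lookup. -/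
theorem acc_look {p : Pending K} {i : ℕ} (h : i < val.length) :
    Acc s t₀ t d (.look p) (unary i ++ inp) val tmp ↔
      Acc s t₀ t d (.restore p (val.getD i fun _ => false)) inp (tmp.reverse ++ val) [] := by
  induction i generalizing val tmp with
  | zero =>
    cases val with
    | nil => simp at h
    | cons v val => exact (acc_look_false p v).trans (acc_restore p v)
  | succ i ih =>
    cases val with
    | nil => simp at h
    | cons v val =>
      simp only [unary, List.replicate_succ, List.cons_append] at ih ⊢
      rw [acc_look_true, ih (by simpa using h)]
      simp

/-- Running out of input or of wires leads to rejection. This is what forces accepted words to have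
well-formed operands. -/
theorem Acc.look_operand {p : Pending K} {w : Word}
    (h : Acc s t₀ t d (.look p) w val tmp) : ∃ i r, w = unary i ++ r ∧ i < val.length := by
  induction w generalizing val tmp with
  | nil => exact absurd h (not_acc_look_nil p)
  | cons b w ih =>
    cases val with
    | nil => exact absurd h (not_acc_look_empty p b)
    | cons v val =>
      cases b with
      | false => exact ⟨0, w, rfl, by simp⟩
      | true =>
        obtain ⟨i, r, rfl, hi⟩ := ih ((acc_look_true p v).1 h)
        exact ⟨i + 1, r, by simp [unary, List.replicate_succ], by simpa using hi⟩

theorem acc_finish_neg (u : Vec K) : Acc s t₀ t d (.restore .neg u) inp val [] ↔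
    Acc s t₀ t d .gate inp ((fun k => !u k) :: val) [] :=
  acc_of_stepAux (m := .env t d) (by simp [body, finish, Mem.env])

theorem acc_finish_fst (b : Bool) (u : Vec K) : Acc s t₀ t d (.restore (.fst b) u) inp val [] ↔
    Acc s t₀ t d (.look (.snd b u)) inp val [] :=
  acc_of_stepAux (m := .env t d) (by simp [body, finish, Mem.env])

theorem acc_finish_and (u v : Vec K) : Acc s t₀ t d (.restore (.snd false u) v) inp val [] ↔
    Acc s t₀ t d .gate inp ((fun k => u k && v k) :: val) [] :=
  acc_of_stepAux (m := .env t d) (by simp [body, finish, Mem.env])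

theorem acc_finish_or (u v : Vec K) : Acc s t₀ t d (.restore (.snd true u) v) inp val [] ↔
    Acc s t₀ t d .gate inp ((fun k => u k || v k) :: val) [] :=
  acc_of_stepAux (m := .env t d) (by simp [body, finish, Mem.env])

/-! #### Gates -/

theorem acc_gate_cons (b : Bool) : Acc s t₀ t d .gate (b :: inp) val tmp ↔
    Acc s t₀ t d (.kind b) inp val tmp :=
  acc_of_stepAux (m := ⟨t, d, some b, none, false⟩) (by simp [body, Mem.env])

theorem acc_const (b : Bool) : Acc s t₀ t d .const (b :: inp) val tmp ↔
    Acc s t₀ t d .gate inp ((fun _ => b) :: val) tmp :=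
  acc_of_stepAux (m := ⟨t, d, some b, none, false⟩) (by simp [body, Mem.env])

theorem not_acc_const_nil : ¬ Acc s t₀ t d .const [] val tmp :=
  not_acc_of_stepAux (m := ⟨t, d, none, none, false⟩) (inp' := []) (val' := val)
    (tmp' := tmp) (by simp [body, Mem.env])

theorem not_acc_kind_nil (b : Bool) : ¬ Acc s t₀ t d (.kind b) [] val tmp :=
  not_acc_of_stepAux (m := ⟨t, d, none, none, false⟩) (inp' := []) (val' := val)
    (tmp' := tmp) (by cases b <;> simp [body, Mem.env])

theorem acc_kind_const : Acc s t₀ t d (.kind false) (false :: inp) val tmp ↔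
    Acc s t₀ t d .const inp val tmp :=
  acc_of_stepAux (m := ⟨t, d, some false, none, false⟩) (by simp [body, Mem.env])

theorem acc_kind_not : Acc s t₀ t d (.kind false) (true :: inp) val tmp ↔
    Acc s t₀ t d (.look .neg) inp val tmp :=
  acc_of_stepAux (m := ⟨t, d, some true, none, false⟩) (by simp [body, Mem.env])

theorem acc_kind_binary (b : Bool) : Acc s t₀ t d (.kind true) (b :: inp) val tmp ↔
    Acc s t₀ t d (.look (.fst b)) inp val tmp :=
  acc_of_stepAux (m := ⟨t, d, some b, none, false⟩) (by simp [body, Mem.env])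

theorem acc_gate_nil : Acc s t₀ t d .gate [] val tmp ↔ ∃ u ∈ val.head?, Verdict t d u := by
  rw [acc_of_stepAux (l' := .final) (m := .env t d) (inp' := []) (val' := val) (tmp' := tmp)
    (by simp [body, Mem.env]), Acc, accepts_of_det]
  simp only [body, stepAux, accepts_halted]
  -- Names the classical decidability instance under which the program was defined.
  change (match val.head? with
    | none => false
    | some u => @decide (Verdict t d u) (Classical.propDecidable _)) = true ↔ _
  cases val <;> simp

/-- The values of a gate in all evaluations, given the values of the earlier wires. -/
def vecValue (g : Gate) (val : List (Vec K)) : Vec K := fun k => g.value (val.map fun v => v k)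

theorem acc_gate_encode {g : Gate} (hg : ∀ i ∈ g.operands, i < val.length) :
    Acc s t₀ t d .gate (g.encode ++ inp) val [] ↔
      Acc s t₀ t d .gate inp (vecValue g val :: val) [] := by
  -- The default vector is constantly `false`, so it projects to the default value used by
  -- `Gate.value`.
  have hD : ∀ (i : ℕ) (k : Fin K),
      (val.map fun v => v k).getD i false = val.getD i (fun _ => false) k := fun i k =>
    List.getD_map val (fun _ => false) (n := i) fun v => v k
  cases g with
  | const b =>
    simp only [Gate.encode, List.cons_append, List.nil_append]
    rw [acc_gate_cons, acc_kind_const, acc_const]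
    rfl
  | not i =>
    simp only [Gate.encode, List.cons_append, List.nil_append]
    rw [acc_gate_cons, acc_kind_not, acc_look (hg i (by simp [Gate.operands])), acc_finish_neg]
    simp only [List.reverse_nil, List.nil_append]
    unfold vecValue
    simp only [Gate.value, hD]
  | and i j =>
    simp only [Gate.encode, List.cons_append, List.nil_append, List.append_assoc]
    rw [acc_gate_cons, acc_kind_binary, acc_look (hg i (by simp [Gate.operands])),
      acc_finish_fst]
    simp only [List.reverse_nil, List.nil_append]
    rw [acc_look (hg j (by simp [Gate.operands])), acc_finish_and]
    simp only [List.reverse_nil, List.nil_append]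
    unfold vecValue
    simp only [Gate.value, hD]
  | or i j =>
    simp only [Gate.encode, List.cons_append, List.nil_append, List.append_assoc]
    rw [acc_gate_cons, acc_kind_binary, acc_look (hg i (by simp [Gate.operands])),
      acc_finish_fst]
    simp only [List.reverse_nil, List.nil_append]
    rw [acc_look (hg j (by simp [Gate.operands])), acc_finish_or]
    simp only [List.reverse_nil, List.nil_append]
    unfold vecValue
    simp only [Gate.value, hD]

theorem Acc.eq_encode {w : Word} (h : Acc s t₀ t d .gate w val []) (hw : w ≠ []) :
    ∃ (g : Gate) (r : Word), w = g.encode ++ r ∧ ∀ i ∈ g.operands, i < val.length := by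
  rcases w with _ | ⟨b, _ | ⟨b', w⟩⟩
  · exact absurd rfl hw
  · exact absurd ((acc_gate_cons b).1 h) (not_acc_kind_nil b)
  rw [acc_gate_cons] at h
  cases b with
  | false =>
    cases b' with
    | false =>
      rw [acc_kind_const] at h
      cases w with
      | nil => exact absurd h not_acc_const_nil
      | cons b w => exact ⟨.const b, w, rfl, by simp [Gate.operands]⟩
    | true =>
      rw [acc_kind_not] at h
      obtain ⟨i, r, rfl, hi⟩ := h.look_operand
      exact ⟨.not i, r, rfl, by simpa [Gate.operands] using hi⟩
  | true =>
    rw [acc_kind_binary] at h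
    obtain ⟨i, r, rfl, hi⟩ := h.look_operand
    -- The second operand is parsed only after the lookup of the first, which has restored the
    -- stack; the bound on it therefore refers to the same wires.
    rw [acc_look hi, acc_finish_fst] at h
    obtain ⟨j, r, rfl, hj⟩ := h.look_operand
    simp only [List.reverse_nil, List.nil_append] at hj
    cases b' with
    | false => exact ⟨.and i j, r, by simp [Gate.encode], by simp [Gate.operands, hi, hj]⟩
    | true => exact ⟨.or i j, r, by simp [Gate.encode], by simp [Gate.operands, hi, hj]⟩

/-- The values of all wires in all evaluations. -/
def vecRun : List Gate → List (Vec K) → List (Vec K)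
  | [], val => val
  | g :: gs, val => vecRun gs (vecValue g val :: val)

theorem map_vecRun (gs : List Gate) (val : List (Vec K)) (k : Fin K) :
    (vecRun gs val).map (fun v => v k) = run gs (val.map fun v => v k) := by
  induction gs generalizing val with
  | nil => rfl
  | cons g gs ih => rw [vecRun, ih]; rfl

theorem length_vecRun (gs : List Gate) (val : List (Vec K)) :
    (vecRun gs val).length = val.length + gs.length := by
  induction gs generalizing val with
  | nil => rfl
  | cons g gs ih => rw [vecRun, ih]; simp only [List.length_cons]; omega

/-- An accepted word is split off gate by gate, each code being nonempty; the height of the value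
stack is the number of earlier wires required by `WellFormed`. -/
theorem acc_gates {w : Word} : Acc s t₀ t d .gate w val [] ↔
    ∃ gs : List Gate, w = gs.flatMap Gate.encode ∧ WellFormed val.length gs ∧
      ∃ u ∈ (vecRun gs val).head?, Verdict t d u := by
  constructor
  · intro h
    induction hn : w.length using Nat.strong_induction_on generalizing w val with
    | _ n ih =>
      by_cases hw : w = []
      · subst hw
        exact ⟨[], rfl, trivial, acc_gate_nil.1 h⟩
      · obtain ⟨g, r, rfl, hg⟩ := h.eq_encode hw
        have hlt : r.length < n := by
          rw [← hn]
          cases g <;> simp [Gate.encode] <;> omega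
        obtain ⟨gs, rfl, hgs, H⟩ := ih r.length hlt ((acc_gate_encode hg).1 h) rfl
        exact ⟨g :: gs, rfl, ⟨hg, hgs⟩, H⟩
  · rintro ⟨gs, rfl, hgs, H⟩
    induction gs generalizing val with
    | nil => exact acc_gate_nil.2 H
    | cons g gs ih => exact (acc_gate_encode hgs.1).2 (ih hgs.2 H)

end Counter

/-! ### The evaluating machine recognises circuits with enough satisfying assignments -/

/-- The codes of the circuits with at least `k` satisfying assignments. -/
def AtLeast (k : ℕ) : Set Word := {w | ∃ c : Circuit, c.encode = w ∧ k ≤ c.count}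

namespace Counter

variable {K : ℕ} {s : Label K} {t₀ t : Fin (K + 1)} {d : Fin K → Fin K → Bool}
  {inp : Word} {val tmp : List (Vec K)}

/-- The assignments are transposed: `V a i` is the value of input `a` in evaluation `i`. Such a `V`
amounts to an injection of `Fin t` into the satisfying assignments, with arbitrary entries for the
evaluations from `t` on. -/
theorem le_count_iff (c : Circuit) : t.val ≤ c.count ↔
    ∃ V : Fin c.arity → Vec K, (∀ i : Fin K, i.val < t.val → c.eval (fun a => V a i) = true) ∧
      ∀ i j : Fin K, i.val < t.val → j.val < t.val → i ≠ j → ∃ a, V a i ≠ V a j := by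
  have ht : t.val ≤ K := by omega
  constructor
  · intro h
    rw [Circuit.count, ← Fintype.card_subtype] at h
    obtain ⟨e⟩ : Nonempty (Fin t.val ↪ {x : Fin c.arity → Bool // c.eval x = true}) :=
      Function.Embedding.nonempty_of_card_le (by rwa [Fintype.card_fin])
    refine ⟨fun a i => if hi : i.val < t.val then (e ⟨i, hi⟩).1 a else false, fun i hi => ?_,
      fun i j hi hj hij => ?_⟩
    · simpa [hi] using (e ⟨i, hi⟩).2
    · by_contra! H
      refine hij (Fin.ext ?_)
      have : e ⟨i, hi⟩ = e ⟨j, hj⟩ := Subtype.ext (funext fun a => by simpa [hi, hj] using H a)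
      simpa using e.injective this
  · rintro ⟨V, h₁, h₂⟩
    have := Finset.card_le_card_of_injOn (s := (Finset.univ : Finset (Fin t.val)))
      (t := Finset.univ.filter fun x : Fin c.arity → Bool => c.eval x = true)
      (fun i a => V a (Fin.castLE ht i)) (fun i _ => by simpa using h₁ (Fin.castLE ht i) i.2)
      (fun i _ j _ hij => by
        by_contra hne
        obtain ⟨a, ha⟩ := h₂ (Fin.castLE ht i) (Fin.castLE ht j) i.2 j.2 (by simpa using hne)
        exact ha (congrFun hij a))
    simpa [Circuit.count] using this

theorem verdict_iff (c : Circuit) (V : Fin c.arity → Vec K) :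
    (∃ u ∈ (vecRun c.gates (List.ofFn V)).head?, Verdict t (differ (List.ofFn V)) u) ↔
      (∀ i : Fin K, i.val < t.val → c.eval (fun a => V a i) = true) ∧
      ∀ i j : Fin K, i.val < t.val → j.val < t.val → i ≠ j → ∃ a, V a i ≠ V a j := by
  have hpos : 0 < (vecRun c.gates (List.ofFn V)).length := by
    rw [length_vecRun, List.length_ofFn]
    exact c.hasOutput
  obtain ⟨u, l, hu⟩ := List.exists_cons_of_length_pos hpos
  have heval : ∀ i, c.eval (fun a => V a i) = u i := by
    intro i
    have : List.ofFn (fun a => V a i) = (List.ofFn V).map fun v => v i := by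
      rw [List.map_ofFn]
      rfl
    rw [Circuit.eval, this, ← map_vecRun, hu]
    rfl
  have hdiff : ∀ i j, differ (List.ofFn V) i j = true ↔ ∃ a, V a i ≠ V a j := by
    intro i j
    simp [differ, List.mem_ofFn]
  simp [hu, Verdict, heval, hdiff]

theorem acc_arity_iff {w : Word} :
    Acc s t₀ t (fun _ _ => false) .arity w [] [] ↔ w ∈ AtLeast t.val := by
  refine (acc_arity (val := [])).trans ?_
  simp only [List.append_nil, acc_gates]
  constructor
  · rintro ⟨vs, r, rfl, gs, rfl, hgs, H⟩
    -- The verdict was reached on some top vector, so there is an output wire.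
    have hpos : 0 < vs.length + gs.length := by
      obtain ⟨u, hu, -⟩ := H
      rw [← length_vecRun]
      rw [Option.mem_def, List.head?_eq_some_iff] at hu
      obtain ⟨l, hl⟩ := hu
      simp [hl]
    refine ⟨⟨vs.length, gs, hgs, hpos⟩, rfl, ?_⟩
    rw [le_count_iff]
    refine ⟨vs.get, ?_⟩
    rw [← verdict_iff ⟨vs.length, gs, hgs, hpos⟩ vs.get]
    simpa only [List.ofFn_get] using H
  · rintro ⟨c, rfl, h⟩
    obtain ⟨V, hV⟩ := (le_count_iff c).1 h
    rw [← verdict_iff] at hV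
    refine ⟨List.ofFn V, _, by rw [List.length_ofFn]; rfl, c.gates, rfl, ?_, hV⟩
    rw [List.length_ofFn]
    exact c.wellFormed

theorem acc_tag {k : ℕ} {t' : Fin (K + 1)} (h : t'.val = t.val + k) :
    Acc s t₀ t d .tag (List.replicate k true ++ false :: inp) val tmp ↔
      Acc s t₀ t' d .arity inp val tmp := by
  induction k generalizing t with
  | zero =>
    obtain rfl : t' = t := Fin.ext h
    exact acc_tag_false
  | succ k ih =>
    rw [List.replicate_succ, List.cons_append, acc_tag_true]
    refine ih ?_
    -- The final threshold `t'` is at most `K`, so the counter in `Fin (K + 1)` does not wrap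
    -- around.
    rw [Fin.val_add_one_of_lt (Fin.lt_def.2 (by rw [Fin.val_last]; omega))]
    omega

end Counter

theorem atLeast_mem_NP (k : ℕ) : AtLeast k ∈ NP := by
  refine ⟨Counter.machine k .arity (Fin.last k), Counter.machine_oracleFree,
    Counter.machine_polyTime, Set.ext fun w => ?_⟩
  rw [Machine.mem_lang, Counter.initCfg_eq]
  exact (Counter.acc_arity_iff (s := .arity) (t₀ := Fin.last k) (t := Fin.last k)).symm

/-- The language of the pairs of a number `k ≤ K`, in unary, and an element of `AtLeast k`
(on words that do not start with such a number, it is unspecified). -/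
def TaggedAtLeast (K : ℕ) : Set Word := (Counter.machine K .tag 0).lang ∅

theorem taggedAtLeast_mem_NP (K : ℕ) : TaggedAtLeast K ∈ NP :=
  ⟨_, Counter.machine_oracleFree, Counter.machine_polyTime, rfl⟩

theorem mem_taggedAtLeast {k K : ℕ} (h : k ≤ K) (w : Word) :
    List.replicate k true ++ false :: w ∈ TaggedAtLeast K ↔ w ∈ AtLeast k := by
  rw [TaggedAtLeast, Machine.mem_lang, Counter.initCfg_eq]
  exact (Counter.acc_tag (t' := ⟨k, by omega⟩) (by simp)).trans Counter.acc_arity_iff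

/-! ### Codes of circuits -/

theorem unary_append_inj {i j : ℕ} {r r' : Word} (h : unary i ++ r = unary j ++ r') :
    i = j ∧ r = r' := by
  induction i generalizing j with
  | zero => cases j <;> simp_all [unary, List.replicate_succ]
  | succ i ih =>
    cases j with
    | zero => simp [unary, List.replicate_succ] at h
    | succ j =>
      simp only [unary, List.replicate_succ, List.cons_append, List.cons.injEq, true_and] at ih h
      simpa using ih h

theorem Gate.encode_append_inj {g g' : Gate} {r r' : Word}
    (h : g.encode ++ r = g'.encode ++ r') : g = g' ∧ r = r' := by
  cases g <;> cases g' <;>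
    simp only [Gate.encode, List.cons_append, List.nil_append, List.append_assoc,
      List.cons.injEq, Bool.false_eq_true, Bool.true_eq_false, false_and, and_false,
      true_and] at h
  · simpa using h
  · obtain ⟨rfl, rfl⟩ := unary_append_inj h
    simp
  all_goals
    obtain ⟨rfl, h'⟩ := unary_append_inj h
    obtain ⟨rfl, rfl⟩ := unary_append_inj h'
    simp

theorem flatMap_encode_injective : Function.Injective (List.flatMap Gate.encode) := by
  intro l l' h
  have hne : ∀ g : Gate, g.encode ≠ [] := fun g => by cases g <;> simp [Gate.encode]
  induction l generalizing l' with
  | nil =>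
    cases l' with
    | nil => rfl
    | cons g l' => simp [hne] at h
  | cons g l ih =>
    cases l' with
    | nil => simp [hne] at h
    | cons g' l' =>
      rw [List.flatMap_cons, List.flatMap_cons] at h
      obtain ⟨rfl, h'⟩ := Gate.encode_append_inj h
      rw [ih h']

/-- All parts of the code are self-delimiting. Thus a word determines its circuit, and the
existential quantifiers in `Counting` and `AtLeast` speak of the same one. -/
theorem Circuit.encode_injective : Function.Injective Circuit.encode := by
  rintro ⟨n, l, _, _⟩ ⟨n', l', _, _⟩ h
  obtain ⟨rfl, h⟩ := unary_append_inj h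
  obtain rfl := flatMap_encode_injective h
  rfl

theorem encode_mem_atLeast {c : Circuit} {k : ℕ} : c.encode ∈ AtLeast k ↔ k ≤ c.count :=
  ⟨fun ⟨_, h, hk⟩ => Circuit.encode_injective h ▸ hk, fun h => ⟨c, rfl, h⟩⟩

theorem encode_mem_counting {c : Circuit} {A : Set ℕ} : c.encode ∈ Counting A ↔ c.count ∈ A :=
  ⟨fun ⟨_, h, hk⟩ => Circuit.encode_injective h ▸ hk, fun h => ⟨c, rfl, h⟩⟩

/-! ### Membership in the boolean hierarchy -/

theorem exists_threshold {A : Set ℕ} (hA : A.Finite ∨ Aᶜ.Finite) :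
    ∃ N, ∀ n, N ≤ n → (n ∈ A ↔ N ∈ A) := by
  rcases hA with h | h
  · obtain ⟨N, hN⟩ := h.bddAbove
    have : ∀ n, N + 1 ≤ n → n ∉ A := fun n hn hA => by have := hN hA; omega
    exact ⟨N + 1, fun n hn => by simp [this n hn, this (N + 1) le_rfl]⟩
  · obtain ⟨N, hN⟩ := h.bddAbove
    have : ∀ n, N + 1 ≤ n → n ∈ A := fun n hn => by
      by_contra hA
      have := hN (Set.mem_compl hA)
      omega
    exact ⟨N + 1, fun n hn => by simp [this n hn, this (N + 1) le_rfl]⟩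

/-- Two levels settle the count `N + 1`: a union adds the counts from `N + 1` on if `N + 1 ∈ A`, and
a difference then removes those from `N + 2` on. If `N + 1 ∉ A`, the union only adds what is removed
again. -/
theorem counting_inter_Iio_mem_BHLevel (A : Set ℕ) (N : ℕ) :
    Counting (A ∩ Set.Iio (N + 1)) ∈ BHLevel (2 * N + 1) := by
  classical
  induction N with
  | zero =>
    refine ⟨_, atLeast_mem_NP (if 0 ∈ A then 0 else 1), _, atLeast_mem_NP 1, ?_⟩
    rw [if_pos (by decide)]
    ext w
    by_cases hw : ∃ c : Circuit, c.encode = w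
    · obtain ⟨c, rfl⟩ := hw
      simp only [Set.mem_sdiff, encode_mem_atLeast, encode_mem_counting, Set.mem_inter_iff,
        Set.mem_Iio]
      rcases Nat.eq_zero_or_pos c.count with h | h
      · rw [h]
        split_ifs with hA <;> simp [hA]
      · simp; omega
    · constructor
      · rintro ⟨c, hc, -⟩
        exact absurd ⟨c, hc⟩ hw
      · rintro ⟨⟨c, hc, -⟩, -⟩
        exact absurd ⟨c, hc⟩ hw
  | succ N ih =>
    refine ⟨_, ⟨_, ih, _, atLeast_mem_NP (if N + 1 ∈ A then N + 1 else N + 2), rfl⟩, _,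
      atLeast_mem_NP (N + 2), ?_⟩
    rw [if_pos (by simp [parity_simps]), if_neg (by simp [parity_simps])]
    ext w
    by_cases hw : ∃ c : Circuit, c.encode = w
    · obtain ⟨c, rfl⟩ := hw
      simp only [Set.mem_sdiff, Set.mem_union, encode_mem_atLeast, encode_mem_counting,
        Set.mem_inter_iff, Set.mem_Iio]
      rcases lt_trichotomy c.count (N + 1) with h | h | h
      · by_cases hc : c.count ∈ A <;> split_ifs <;> simp [hc] <;> omega
      · rw [h]
        split_ifs with hA <;> simp [hA]
      · split_ifs <;> omega
    · constructor
      · rintro ⟨c, hc, -⟩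
        exact absurd ⟨c, hc⟩ hw
      · rintro ⟨⟨c, hc, -⟩ | ⟨c, hc, -⟩, -⟩ <;> exact absurd ⟨c, hc⟩ hw

/-- If `N ∈ A`, one more union supplies all counts from `N` on; otherwise `A` has no elements there.
-/
theorem counting_mem_BH {A : Set ℕ} (hA : A.Finite ∨ Aᶜ.Finite) : Counting A ∈ BH := by
  obtain ⟨N, hN⟩ := exists_threshold hA
  by_cases h : N ∈ A
  · refine ⟨2 * N + 1 + 1, _, counting_inter_Iio_mem_BHLevel A N, _, atLeast_mem_NP N, ?_⟩
    rw [if_neg (by simp [parity_simps])]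
    ext w
    constructor
    · rintro ⟨c, rfl, hc⟩
      rcases lt_or_ge c.count N with hlt | hle
      · exact Or.inl ⟨c, rfl, hc, Nat.lt_succ_of_lt hlt⟩
      · exact Or.inr ⟨c, rfl, hle⟩
    · rintro (⟨c, rfl, hc⟩ | ⟨c, rfl, hc⟩)
      · exact ⟨c, rfl, hc.1⟩
      · exact ⟨c, rfl, (hN _ hc).2 h⟩
  · have : A ∩ Set.Iio (N + 1) = A := by
      refine Set.inter_eq_left.2 fun n hn => ?_
      by_contra hlt
      exact h ((hN n (by simp at hlt; omega)).1 hn)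
    exact ⟨_, this ▸ counting_inter_Iio_mem_BHLevel A N⟩

/-! ### Simulation of an oracle `Counting A` by an oracle in `NP` -/

/-- `AtLeast 0` consists of all codes, so `t = 0` means that `w` is not a code; the condition `t ≠
0` also keeps the truncated `0 - 1` from being taken for the count 0. -/
theorem mem_counting_of_notMem_atLeast {A : Set ℕ} {w : Word} {t : ℕ}
    (h : ∀ j < t, w ∈ AtLeast j) (ht : w ∉ AtLeast t) :
    w ∈ Counting A ↔ t ≠ 0 ∧ t - 1 ∈ A := by
  cases t with
  | zero =>
    simp only [ne_eq, not_true_eq_false, false_and, iff_false]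
    rintro ⟨c, rfl, -⟩
    exact ht ⟨c, rfl, Nat.zero_le _⟩
  | succ t =>
    obtain ⟨c, rfl, hc⟩ := h t (Nat.lt_succ_self t)
    rw [encode_mem_atLeast] at ht
    obtain rfl : t = c.count := by omega
    simp [encode_mem_counting]

theorem mem_counting_of_mem_atLeast {A : Set ℕ} {N : ℕ} (hN : ∀ n, N ≤ n → (n ∈ A ↔ N ∈ A))
    {w : Word} (h : w ∈ AtLeast N) : w ∈ Counting A ↔ N ∈ A := by
  obtain ⟨c, rfl, hc⟩ := h
  rw [encode_mem_counting, hN _ hc]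

namespace Simulation

open Turing.TM2

/-- The phases of the simulation of a query: a tag is put in front of the query, the oracle is
asked, and the tag is removed after a positive or a negative answer. -/
inductive Phase where
  | put | query | hit | miss
  deriving DecidableEq

instance : Fintype Phase := ⟨{.put, .query, .hit, .miss}, fun p => by cases p <;> simp⟩

variable (M : Machine) (A : Set ℕ) (N : ℕ)

/-- The control states: those of the given machine, and, for every query with its two possible
continuations, the phases of its simulation with a given tag. -/
abbrev Label : Type := M.Λ ⊕ (Phase × M.Λ × M.Λ × Fin (N + 1))

/-- The statements of the simulating machine. -/
abbrev SStmt : Type := Stmt M.Γ (Label M N) M.σ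

/-- The configurations of the simulating machine. -/
abbrev SCfg : Type := Cfg M.Γ (Label M N) M.σ

variable {M N}

/-- A statement of the given machine as a statement of the simulating machine. -/
def lift : Stmt M.Γ M.Λ M.σ → SStmt M N
  | .push k f q => .push k f (lift q)
  | .peek k f q => .peek k f (lift q)
  | .pop k f q => .pop k f (lift q)
  | .load f q => .load f (lift q)
  | .branch f q₁ q₂ => .branch f (lift q₁) (lift q₂)
  | .goto f => .goto fun v => .inl (f v)
  | .halt => .halt

variable (N) in
/-- A configuration of the given machine as a configuration of the simulating machine. -/
def embed (c : M.Cfg) : SCfg M N := ⟨c.l.map .inl, c.var, c.stk⟩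

theorem stepAux_lift (q : Stmt M.Γ M.Λ M.σ) (v : M.σ) (S : ∀ k, List (M.Γ k)) :
    stepAux (lift q) v S = embed N (stepAux q v S) := by
  induction q generalizing v S with
  | branch f q₁ q₂ ih₁ ih₂ =>
    simp only [lift, stepAux]
    cases f v
    · exact ih₂ v S
    · exact ih₁ v S
  | goto f => rfl
  | halt => rfl
  | _ => simp only [lift, stepAux, *]

/-- Push some copies of the letter `1` on the query stack. -/
def pushOnes : ℕ → SStmt M N → SStmt M N
  | 0, q => q
  | n + 1, q => .push M.qry (fun _ => M.qryEquiv.symm true) (pushOnes n q)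

/-- Remove some letters from the query stack. -/
def popMany : ℕ → SStmt M N → SStmt M N
  | 0, q => q
  | n + 1, q => .pop M.qry (fun v _ => v) (popMany n q)

theorem stepAux_pushOnes (n : ℕ) (q : SStmt M N) (v : M.σ) (S : ∀ k, List (M.Γ k))
    (L : List (M.Γ M.qry)) :
    stepAux (pushOnes n q) v (Function.update S M.qry L) =
      stepAux q v (Function.update S M.qry (List.replicate n (M.qryEquiv.symm true) ++ L)) := by
  induction n generalizing L with
  | zero => rfl
  | succ n ih =>
    rw [pushOnes, stepAux, Function.update_self, Function.update_idem, ih, List.replicate_succ',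
      List.append_assoc]
    rfl

/-- Only the number of letters removed matters, so the tag vanishes and the stacks of the simulated
machine reappear unchanged. -/
theorem stepAux_popMany (q : SStmt M N) (v : M.σ) (S : ∀ k, List (M.Γ k))
    (L : List (M.Γ M.qry)) :
    stepAux (popMany L.length q) v (Function.update S M.qry (L ++ S M.qry)) = stepAux q v S := by
  induction L with
  | nil => simp [popMany]
  | cons a L ih =>
    rw [List.length_cons, popMany, stepAux, Function.update_self, Function.update_idem]
    exact ih

variable (M N)

open Classical in
/-- The program of the simulating machine. -/
noncomputable def prog : Label M N → Instr M.Γ (Label M N) M.σ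
  | .inl l => match M.prog l with
    | .det s => .det (lift s)
    | .guess l₀ l₁ => .guess (.inl l₀) (.inl l₁)
    | .ask yes no => .det (.goto fun _ => .inr (.put, yes, no, 0))
  | .inr (.put, yes, no, t) =>
    .det (.push M.qry (fun _ => M.qryEquiv.symm false)
      (pushOnes t (.goto fun _ => .inr (.query, yes, no, t))))
  | .inr (.query, yes, no, t) => .ask (.inr (.hit, yes, no, t)) (.inr (.miss, yes, no, t))
  | .inr (.hit, yes, no, t) =>
    .det (popMany (t + 1) (.goto fun _ =>
      if h : t.val < N then .inr (.put, yes, no, ⟨t + 1, by omega⟩)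
      else .inl (if N ∈ A then yes else no)))
  | .inr (.miss, yes, no, t) =>
    .det (popMany (t + 1) (.goto fun _ =>
      .inl (if t.val ≠ 0 ∧ t.val - 1 ∈ A then yes else no)))

/-- The simulating machine. -/
noncomputable def machine : Machine where
  K := M.K
  Γ := M.Γ
  Λ := Label M N
  σ := M.σ
  decK := M.decK
  finK := M.finK
  finΓ := M.finΓ
  finΛ := by
    have := M.finΛ
    infer_instance
  finσ := M.finσ
  inp := M.inp
  inpEquiv := M.inpEquiv
  qry := M.qry
  qryEquiv := M.qryEquiv
  start := .inl M.start
  init := M.init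
  prog := prog M A N
  accept := M.accept

theorem machine_deterministic (hM : M.Deterministic) : (machine M A N).Deterministic := by
  have key : ∀ l l₀ l₁, prog M A N l ≠ .guess l₀ l₁ := by
    rintro (l | ⟨_ | _ | _ | _, yes, no, t⟩) l₀ l₁ <;> simp only [prog, ne_eq, reduceCtorEq,
      not_false_eq_true]
    have := hM l
    split <;> simp_all
  exact key

/-! ### Correctness and cost of the simulation -/

/-- The simulating machine passes from one configuration to another one in `n` steps. -/
def Reach : ℕ → SCfg M N → SCfg M N → Prop := (machine M A N).Reach (TaggedAtLeast N)

variable {M A N}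

theorem reach_det {l : Label M N} {q : SStmt M N} (h : prog M A N l = .det q) (v : M.σ)
    (S : ∀ k, List (M.Γ k)) : Reach M A N 1 ⟨some l, v, S⟩ (stepAux q v S) :=
  .step (Machine.next_det (M := machine M A N) h v S) (.refl _)

open Classical in
theorem reach_ask {l yes no : Label M N} (h : prog M A N l = .ask yes no) (v : M.σ)
    (S : ∀ k, List (M.Γ k)) : Reach M A N 1 ⟨some l, v, S⟩
      ⟨some (if (S M.qry).map M.qryEquiv ∈ TaggedAtLeast N then yes else no), v, S⟩ :=
  .step (Machine.next_ask (M := machine M A N) h v S) (.refl _)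

theorem Reach.trans {m n : ℕ} {c₁ c₂ c₃ : SCfg M N} (h : Reach M A N m c₁ c₂)
    (h' : Reach M A N n c₂ c₃) : Reach M A N (m + n) c₁ c₃ :=
  Machine.Reach.trans h h'

/-- The query stack with a tag. -/
def tagged (t : ℕ) (S : ∀ k, List (M.Γ k)) : ∀ k, List (M.Γ k) :=
  Function.update S M.qry
    ((List.replicate t (M.qryEquiv.symm true) ++ [M.qryEquiv.symm false]) ++ S M.qry)

theorem stepAux_popMany_tagged (t : ℕ) (q : SStmt M N) (v : M.σ) (S : ∀ k, List (M.Γ k)) :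
    stepAux (popMany (t + 1) q) v (tagged t S) = stepAux q v S := by
  have := stepAux_popMany q v S
    (List.replicate t (M.qryEquiv.symm true) ++ [M.qryEquiv.symm false])
  simpa [tagged] using this

theorem tagged_qry (t : ℕ) (S : ∀ k, List (M.Γ k)) : (tagged t S M.qry).map M.qryEquiv =
    List.replicate t true ++ false :: (S M.qry).map M.qryEquiv := by
  simp [tagged]

open Classical in
theorem reach_answer (t : Fin (N + 1)) (yes no : M.Λ) (v : M.σ) (S : ∀ k, List (M.Γ k)) :
    Reach M A N 2 ⟨some (.inr (.put, yes, no, t)), v, S⟩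
      ⟨some (if (S M.qry).map M.qryEquiv ∈ AtLeast t then .inr (.hit, yes, no, t)
        else .inr (.miss, yes, no, t)), v, tagged t S⟩ := by
  have h₁ := reach_det (M := M) (A := A) (l := .inr (.put, yes, no, t)) rfl v S
  rw [stepAux, stepAux_pushOnes, stepAux] at h₁
  have h₂ := reach_ask (M := M) (A := A) (l := .inr (.query, yes, no, t)) rfl v (tagged t S)
  rw [tagged_qry] at h₂
  simp only [mem_taggedAtLeast (Nat.lt_succ_iff.1 t.isLt)] at h₂
  refine Reach.trans ?_ h₂
  simpa [tagged] using h₁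

open Classical in
-- Each tag costs three steps: put it, ask, remove it; a whole tag is pushed or popped within one
-- statement. All smaller thresholds have been confirmed, so a refusal at `t` fixes the answer, and
-- `d` counts the tags left before `N`.
theorem reach_query (hN : ∀ n, N ≤ n → (n ∈ A ↔ N ∈ A)) (d : ℕ) (t : Fin (N + 1))
    (hd : t.val + d = N) (yes no : M.Λ) (v : M.σ) (S : ∀ k, List (M.Γ k))
    (h : ∀ j < t.val, (S M.qry).map M.qryEquiv ∈ AtLeast j) :
    ∃ n ≤ 3 * (d + 1), Reach M A N n ⟨some (.inr (.put, yes, no, t)), v, S⟩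
      ⟨some (.inl (if (S M.qry).map M.qryEquiv ∈ Counting A then yes else no)), v, S⟩ := by
  induction d generalizing t with
  | zero =>
    have h₁ := reach_answer (A := A) t yes no v S
    by_cases hw : (S M.qry).map M.qryEquiv ∈ AtLeast t
    · rw [if_pos hw] at h₁
      have h₂ := reach_det (M := M) (A := A) (l := .inr (.hit, yes, no, t)) rfl v (tagged t S)
      rw [stepAux_popMany_tagged, stepAux, dif_neg (by omega)] at h₂
      have ht : t.val = N := by omega
      simp only [mem_counting_of_mem_atLeast hN (ht ▸ hw)]
      exact ⟨_, le_rfl, h₁.trans h₂⟩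
    · rw [if_neg hw] at h₁
      have h₂ := reach_det (M := M) (A := A) (l := .inr (.miss, yes, no, t)) rfl v (tagged t S)
      rw [stepAux_popMany_tagged, stepAux] at h₂
      simp only [mem_counting_of_notMem_atLeast h hw]
      exact ⟨_, le_rfl, h₁.trans h₂⟩
  | succ d ih =>
    have h₁ := reach_answer (A := A) t yes no v S
    by_cases hw : (S M.qry).map M.qryEquiv ∈ AtLeast t
    · rw [if_pos hw] at h₁
      have h₂ := reach_det (M := M) (A := A) (l := .inr (.hit, yes, no, t)) rfl v (tagged t S)
      rw [stepAux_popMany_tagged, stepAux, dif_pos (by omega)] at h₂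
      obtain ⟨n, hn, h₃⟩ := ih ⟨t + 1, by omega⟩ (by simp only; omega) fun j hj => by
        rcases Nat.lt_succ_iff_lt_or_eq.1 hj with hj | rfl
        · exact h j hj
        · exact hw
      exact ⟨_, by omega, (h₁.trans h₂).trans h₃⟩
    · rw [if_neg hw] at h₁
      have h₂ := reach_det (M := M) (A := A) (l := .inr (.miss, yes, no, t)) rfl v (tagged t S)
      rw [stepAux_popMany_tagged, stepAux] at h₂
      simp only [mem_counting_of_notMem_atLeast h hw]
      exact ⟨_, by omega, h₁.trans h₂⟩

/-- The bound is one step to enter the simulation of a query plus three for each of the `N + 1`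
tags. It does not depend on the configuration, so the running time grows by a constant factor. -/
theorem exists_next (hN : ∀ n, N ≤ n → (n ∈ A ↔ N ∈ A)) (hM : M.Deterministic) {c : M.Cfg}
    (hc : c.l ≠ none) : ∃ c', M.next (Counting A) c = {c'} ∧
      ∃ n ≤ 3 * (N + 1) + 1, Reach M A N n (embed N c) (embed N c') := by
  obtain ⟨_ | l, v, S⟩ := c
  · exact absurd rfl hc
  cases hl : M.prog l with
  | det s =>
    refine ⟨_, Machine.next_det hl v S, 1, by omega, ?_⟩
    rw [← stepAux_lift]
    exact reach_det (by simp only [prog, hl]) v S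
  | guess l₀ l₁ => exact absurd hl (hM l l₀ l₁)
  | ask yes no =>
    refine ⟨_, Machine.next_ask hl v S, ?_⟩
    have h₁ : Reach M A N 1 (embed N ⟨some l, v, S⟩) ⟨some (.inr (.put, yes, no, 0)), v, S⟩ :=
      reach_det (q := .goto fun _ => .inr (.put, yes, no, 0)) (by simp only [prog, hl]) v S
    obtain ⟨n, hn, h₂⟩ := reach_query hN N 0 (by simp) yes no v S (by simp)
    exact ⟨_, by omega, h₁.trans h₂⟩

theorem embed_correct_of_halted {O O' : Set Word} {t : ℕ} {c : M.Cfg} (hc : c.l = none) :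
    ((machine M A N).Accepts O' (embed N c) ↔ M.Accepts O c) ∧
      (machine M A N).HaltsWithin O' t (embed N c) := by
  have hc' : (embed N c).l = none := by simp [embed, hc]
  constructor
  · rw [Machine.accepts_of_halted hc]
    exact Machine.accepts_of_halted hc'
  · exact Machine.HaltsWithin.mono (s := 0)
      (Machine.next_of_halted (M := machine M A N) hc') (Nat.zero_le _)

theorem embed_correct (hN : ∀ n, N ≤ n → (n ∈ A ↔ N ∈ A)) (hM : M.Deterministic) {t : ℕ}
    {c : M.Cfg} (h : M.HaltsWithin (Counting A) t c) :
    ((machine M A N).Accepts (TaggedAtLeast N) (embed N c) ↔ M.Accepts (Counting A) c) ∧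
      (machine M A N).HaltsWithin (TaggedAtLeast N) ((3 * (N + 1) + 1) * t) (embed N c) := by
  induction t generalizing c with
  | zero =>
    by_cases hc : c.l = none
    · exact embed_correct_of_halted hc
    -- A deterministic machine that has not halted always has a successor, contradicting a time
    -- bound of 0.
    · obtain ⟨c', hn, -⟩ := exists_next hN hM hc
      simp [Machine.HaltsWithin, hn] at h
  | succ t ih =>
    by_cases hc : c.l = none
    · exact embed_correct_of_halted hc
    · obtain ⟨c', hn, n, hle, hr⟩ := exists_next hN hM hc
      obtain ⟨h₁, h₂⟩ := ih (h c' (by simp [hn]))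
      refine ⟨?_, (Machine.Reach.haltsWithin hr h₂).mono (by rw [Nat.mul_succ _ t]; omega)⟩
      rw [Machine.accepts_of_next_eq hn, ← h₁]
      exact Machine.Reach.accepts_iff hr

theorem polyTuringReducible (hN : ∀ n, N ≤ n → (n ∈ A ↔ N ∈ A)) {L : Set Word}
    (h : PolyTuringReducible L (Counting A)) : PolyTuringReducible L (TaggedAtLeast N) := by
  obtain ⟨M, hM, ⟨p, hp⟩, rfl⟩ := h
  refine ⟨machine M A N, machine_deterministic M A N hM,
    ⟨.C (3 * (N + 1) + 1) * p, fun x => ?_⟩, Set.ext fun x => ?_⟩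
  · rw [Polynomial.eval_mul, Polynomial.eval_C]
    exact (embed_correct hN hM (hp x)).2
  · rw [Machine.mem_lang, Machine.mem_lang]
    exact (embed_correct hN hM (hp x)).1.symm

end Simulation

end CircuitCounting

theorem mainTheorem4 (A : Set ℕ) (hA : A.Finite ∨ Aᶜ.Finite) :
    CircuitCounting.Counting A ∈ CircuitCounting.BH ∧
    (CircuitCounting.IsHard CircuitCounting.SPP (CircuitCounting.Counting A) →
      CircuitCounting.SPP ⊆ CircuitCounting.PNP) := by
  refine ⟨CircuitCounting.counting_mem_BH hA, fun h L hL => ?_⟩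
  obtain ⟨N, hN⟩ := CircuitCounting.exists_threshold hA
  exact ⟨_, CircuitCounting.taggedAtLeast_mem_NP N,
    CircuitCounting.Simulation.polyTuringReducible hN (h L hL)⟩
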